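/- Let $a,h>0$, $0\le p\le 1$, $0<\alpha<1$, and let $p_{i,j,k}\ge 0$ ($i,j\in\{0,1\}$, $k\in\{0,1,2\}$) satisfy $\sum_{k}p_{i,0,k}=1-p$ and $\sum_{k}p_{i,1,k}=1$ for $i=0,1$. For $i,j\in\{0,1\}$ let $$\mathcal V_{i,j}=\Bigl\{\Bigl(a\bigl((-1)^{i+1}\mathbf 1_{j=1}+\tfrac32k\bigr),\,a\bigl(\tfrac{\sqrt3}{2}k+\sqrt3\,\ell\bigr),\,h\bigl(2n+\mathbf 1_{i\ne j}\bigr)\Bigr):k,\ell,n\in\mathbb Z\Bigr\}\subset\mathbb R^3 .$$ The random walk on graphite (the $2h$ structure) is the Markov chain $(S_n)_{n\ge0}$ with $S_0=(0,0,0)$ and the following transitions. From a point of $\mathcal V_{i,j}$ it jumps by $\bigl(a\cos(\tfrac23k\pi+i\pi),\,a\sin(\tfrac23k\pi+i\pi),\,0\bigr)$ with probability $p_{i,j,k}$, $k=0,1,2$; from a point of $\mathcal V_{i,0}$ it moreover jumps by $(0,0,h)$ with probability $\alpha p$ and by $(0,0,-h)$ with probability $(1-\alpha)p$. Put $u_{i,j}=p_{i,j,1}+p_{i,j,2}$,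 $v_{i,j}=p_{i,j,1}-p_{i,j,2}$, $s_{i,j}=u_{i,j}(1-u_{i,j})$, $t_{i,j}=v_{i,j}(u_{i,j}-1)$, and define the column vectors $$\mu=\begin{pmatrix}\frac{3a}{8}\bigl(-(u_{0,0}+u_{0,1})+(u_{1,0}+u_{1,1})\bigr)\\ \frac{a\sqrt3}{8}\bigl((v_{0,0}+v_{0,1})-(v_{1,0}+v_{1,1})\bigr)\\ \frac{hp}{2}(2\alpha-1)\end{pmatrix},\qquad m=\begin{pmatrix}\frac{3a}{8}\bigl(-(u_{0,0}-u_{0,1})+(u_{1,0}-u_{1,1})\bigr)\\ \frac{a\sqrt3}{8}\bigl((v_{0,0}-v_{0,1})-(v_{1,0}-v_{1,1})\bigr)\\ \frac{hp}{2}(2\alpha-1)\end{pmatrix},$$ $$\theta=\begin{pmatrix}a\bigl((1-\frac p2)-\frac38(u_{0,0}+u_{0,1}+u_{1,0}+u_{1,1})\bigr)\\ \frac{a\sqrt3}{8}\bigl(v_{0,0}+v_{0,1}+v_{1,0}+v_{1,1}\bigr)\\0\end{pmatrix},\qquad \rho=\begin{pmatrix}a\bigl(-\frac p2-\frac38((u_{0,0}-u_{0,1})+(u_{1,0}-u_{1,1}))\bigr)\\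 \frac{a\sqrt3}{8}\bigl((v_{0,0}-v_{0,1})+(v_{1,0}-v_{1,1})\bigr)\\0\end{pmatrix},\qquad \zeta=\begin{pmatrix}0\\0\\hp(2\alpha-1)\end{pmatrix}.$$ Define the symmetric $3\times3$ matrices $\sigma^2$, $\gamma$, $\delta$ as follows, where the upper sign is for $\sigma^2$ and the lower sign for $\gamma$: $$\begin{aligned} (1,1):&\ \tfrac{a^2}{4}\bigl(2p(1-p)+\tfrac94(s_{0,0}+s_{1,0}\pm s_{0,1}\pm s_{1,1})-3p(u_{0,0}+u_{1,0})\bigr),\\ (2,2):&\ \tfrac{3a^2}{16}\bigl((u_{0,0}+u_{1,0}\pm u_{0,1}\pm u_{1,1})-(v_{0,0}^2+v_{1,0}^2\pm v_{0,1}^2\pm v_{1,1}^2)\bigr),\\ (1,2):&\ \tfrac{a^2\sqrt3}{16}\bigl(3(t_{0,0}+t_{1,0}\pm t_{0,1}\pm t_{1,1})+2p(v_{0,0}+v_{1,0})\bigr), \end{aligned}$$ and, both for $\sigma^2$ and for $\gamma$, $$\begin{aligned} (3,3):&\ \tfrac{h^2p}{2}\bigl(1-p(2\alpha-1)^2\bigr),\qquad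 (1,3):\ \tfrac{3ah}{8}\,p(2\alpha-1)(u_{0,0}-u_{1,0}),\qquad (2,3):\ -\tfrac{ah\sqrt3}{8}\,p(2\alpha-1)(v_{0,0}-v_{1,0}); \end{aligned}$$ while $\delta$ has the entries $$\begin{aligned} \delta_{11}&=\tfrac{a^2}{4}\bigl(\tfrac94(s_{0,0}-s_{1,0}-s_{0,1}+s_{1,1})-3p(u_{0,0}-u_{1,0})\bigr),\\ \delta_{22}&=\tfrac{3a^2}{16}\bigl((u_{0,0}-u_{1,0}-u_{0,1}+u_{1,1})-(v_{0,0}^2-v_{1,0}^2-v_{0,1}^2+v_{1,1}^2)\bigr),\\ \delta_{12}&=\tfrac{a^2\sqrt3}{16}\bigl(3(t_{0,0}-t_{1,0}-t_{0,1}+t_{1,1})+2p(v_{0,0}-v_{1,0})\bigr),\\ \delta_{13}&=\tfrac{ah}{8}\bigl(-4p(1-p)(2\alpha-1)+3p(2\alpha-1)(u_{0,0}+u_{1,0})\bigr),\\ \delta_{23}&=-\tfrac{ah\sqrt3}{8}\,p(2\alpha-1)(v_{0,0}+v_{1,0}),\qquad \delta_{33}=0 . \end{aligned}$$ If $p>0$,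 then $$\frac{1}{\sqrt n}\Bigl(S_n-n\mu-n\frac{p}{2-p}m\Bigr)\ \xrightarrow{\ \mathcal L\ }\ \mathcal N(0,\Gamma),$$ where the positive semidefinite matrix $\Gamma$ is $$\Gamma=\sigma^2+\frac{p}{2-p}\gamma+\frac{2}{(2-p)^2}\bigl((\zeta-p\mu)m^T+m(\zeta-p\mu)^T\bigr)-\frac{4p}{(2-p)^3}mm^T+\frac{2}{2-p}\bigl(\theta\rho^T+\rho\theta^T\bigr)+\frac{4}{p(2-p)}\rho\rho^T .$$ If $p=0$, then $$\frac{1}{\sqrt n}\bigl(S_n-n(\mu+\rho)\bigr)\ \xrightarrow{\ \mathcal L\ }\ \mathcal N(0,\sigma^2+\delta),$$ where $\sigma^2+\delta$ is positive semidefinite. -/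

import Mathlib

open MeasureTheory ProbabilityTheory Filter Topology Matrix

namespace Graphite

/-- Three-dimensional Euclidean space. -/
abbrev E3 : Type := EuclideanSpace ℝ (Fin 3)

/-- The parameters of the random walk on the `2h` structure of graphite.

* `a` is the distance between adjacent vertices of the same sheet, `h` the distance between
  consecutive sheets;
* `p` is the probability to leave the sheet from a vertex which allows it, and `α` the conditional
  probability that such a jump goes upwards;
* `prob i j k` is the probability of the `k`-th horizontal jump from a vertex of type `(i, j)`. -/
structure Params where
  a : ℝ
  h : ℝ
  p : ℝ
  α : ℝ
  prob : Fin 2 → Fin 2 → Fin 3 → ℝ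
  a_pos : 0 < a
  h_pos : 0 < h
  p_nonneg : 0 ≤ p
  p_le_one : p ≤ 1
  α_pos : 0 < α
  α_lt_one : α < 1
  prob_nonneg : ∀ i j k, 0 ≤ prob i j k
  sum_prob_zero : ∀ i, ∑ k, prob i 0 k = 1 - p
  sum_prob_one : ∀ i, ∑ k, prob i 1 k = 1

namespace Params

variable (G : Params)

/-- The set of vertices of type `(i, j)`. The index `i` is the colour of the vertex, and `j = 0` if
the particle can move to an adjacent sheet from this vertex, `j = 1` otherwise. -/
def vertices (i j : Fin 2) : Set E3 :=
  {s | ∃ k l n : ℤ, s =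
    !₂[G.a * ((-1) ^ ((i : ℕ) + 1) * (if j = 1 then 1 else 0) + 3 / 2 * (k : ℝ)),
       G.a * (√3 / 2 * (k : ℝ) + √3 * (l : ℝ)),
       G.h * (2 * (n : ℝ) + (if i ≠ j then 1 else 0))]}

/-- The vertical displacement to the sheet just above. -/
noncomputable def up : E3 := !₂[0, 0, G.h]

/-- The `k`-th horizontal displacement from a vertex of colour `i`. -/
noncomputable def step (i : Fin 2) (k : Fin 3) : E3 :=
  !₂[G.a * Real.cos (2 / 3 * ((k : ℕ) : ℝ) * Real.pi + ((i : ℕ) : ℝ) * Real.pi),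
     G.a * Real.sin (2 / 3 * ((k : ℕ) : ℝ) * Real.pi + ((i : ℕ) : ℝ) * Real.pi),
     0]

/-- The event that the path `S` agrees with `x` up to time `n`. -/
def history {Ω : Type*} (S : ℕ → Ω → E3) (x : ℕ → E3) (n : ℕ) : Set Ω :=
  {ω | ∀ k ≤ n, S k ω = x k}

/-- `S` is a random walk on graphite with parameters `G`, under the probability measure `P`: it
starts at the origin, and it is a Markov chain whose transition probabilities depend on the type of
the vertex at which the particle is located. -/
structure IsRandomWalk {Ω : Type*} [MeasurableSpace Ω] (P : Measure Ω) (S : ℕ → Ω → E3) :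
    Prop where
  measurable : ∀ n, Measurable (S n)
  start : ∀ᵐ ω ∂P, S 0 ω = 0
  jump_up : ∀ (i : Fin 2) (n : ℕ) (x : ℕ → E3), x n ∈ G.vertices i 0 → P (history S x n) ≠ 0 →
    (P[|history S x n]).real {ω | S (n + 1) ω = x n + G.up} = G.α * G.p
  jump_down : ∀ (i : Fin 2) (n : ℕ) (x : ℕ → E3), x n ∈ G.vertices i 0 → P (history S x n) ≠ 0 →
    (P[|history S x n]).real {ω | S (n + 1) ω = x n - G.up} = (1 - G.α) * G.p
  jump_horizontal : ∀ (i j : Fin 2) (k : Fin 3) (n : ℕ) (x : ℕ → E3), x n ∈ G.vertices i j →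
    P (history S x n) ≠ 0 →
    (P[|history S x n]).real {ω | S (n + 1) ω = x n + G.step i k} = G.prob i j k

/-- `u i j = p_{i,j,1} + p_{i,j,2}`. -/
def u (i j : Fin 2) : ℝ := G.prob i j 1 + G.prob i j 2

/-- `v i j = p_{i,j,1} - p_{i,j,2}`. -/
def v (i j : Fin 2) : ℝ := G.prob i j 1 - G.prob i j 2

/-- `s i j = u_{i,j} (1 - u_{i,j})`. -/
def s (i j : Fin 2) : ℝ := G.u i j * (1 - G.u i j)

/-- `t i j = v_{i,j} (u_{i,j} - 1)`. -/
def t (i j : Fin 2) : ℝ := G.v i j * (G.u i j - 1)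

/-- The vector `μ`. -/
noncomputable def μ : E3 :=
  !₂[3 * G.a / 8 * (-(G.u 0 0 + G.u 0 1) + (G.u 1 0 + G.u 1 1)),
     G.a * √3 / 8 * ((G.v 0 0 + G.v 0 1) - (G.v 1 0 + G.v 1 1)),
     G.h * G.p / 2 * (2 * G.α - 1)]

/-- The vector `m`. -/
noncomputable def m : E3 :=
  !₂[3 * G.a / 8 * (-(G.u 0 0 - G.u 0 1) + (G.u 1 0 - G.u 1 1)),
     G.a * √3 / 8 * ((G.v 0 0 - G.v 0 1) - (G.v 1 0 - G.v 1 1)),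
     G.h * G.p / 2 * (2 * G.α - 1)]

/-- The vector `θ`. -/
noncomputable def θ : E3 :=
  !₂[G.a * ((1 - G.p / 2) - 3 / 8 * ((G.u 0 0 + G.u 0 1) + (G.u 1 0 + G.u 1 1))),
     G.a * √3 / 8 * ((G.v 0 0 + G.v 0 1) + (G.v 1 0 + G.v 1 1)),
     0]

/-- The vector `ρ`. -/
noncomputable def ρ : E3 :=
  !₂[G.a * (-(G.p / 2) - 3 / 8 * ((G.u 0 0 - G.u 0 1) + (G.u 1 0 - G.u 1 1))),
     G.a * √3 / 8 * ((G.v 0 0 - G.v 0 1) + (G.v 1 0 - G.v 1 1)),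
     0]

/-- The vector `ζ`. -/
noncomputable def ζ : E3 := !₂[0, 0, G.h * G.p * (2 * G.α - 1)]

/-- The entry `(1, 3)` shared by `σ²` and `γ`. -/
noncomputable def c13 : ℝ :=
  G.a * G.h / 8 * (3 * G.p * (2 * G.α - 1) * (G.u 0 0 - G.u 1 0))

/-- The entry `(2, 3)` shared by `σ²` and `γ`. -/
noncomputable def c23 : ℝ :=
  -(G.a * G.h * √3 / 8) * (G.p * (2 * G.α - 1) * (G.v 0 0 - G.v 1 0))

/-- The entry `(3, 3)` shared by `σ²` and `γ`. -/
noncomputable def c33 : ℝ := G.h ^ 2 * G.p / 2 * (1 - G.p * (2 * G.α - 1) ^ 2)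

/-- The entry `σ₁²` of `σ²`. -/
noncomputable def σ11 : ℝ :=
  G.a ^ 2 / 4 * (2 * G.p * (1 - G.p) + 9 / 4 * (G.s 0 0 + G.s 1 0 + G.s 0 1 + G.s 1 1)
    - 3 * G.p * (G.u 0 0 + G.u 1 0))

/-- The entry `σ₂²` of `σ²`. -/
noncomputable def σ22 : ℝ :=
  3 * G.a ^ 2 / 16 * ((G.u 0 0 + G.u 1 0 + G.u 0 1 + G.u 1 1)
    - (G.v 0 0 ^ 2 + G.v 1 0 ^ 2 + G.v 0 1 ^ 2 + G.v 1 1 ^ 2))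

/-- The entry `σ_{1,2}` of `σ²`. -/
noncomputable def σ12 : ℝ :=
  G.a ^ 2 * √3 / 16 * (3 * (G.t 0 0 + G.t 1 0 + G.t 0 1 + G.t 1 1)
    + 2 * G.p * (G.v 0 0 + G.v 1 0))

/-- The matrix `σ²`. -/
noncomputable def sigmaSq : Matrix (Fin 3) (Fin 3) ℝ :=
  !![G.σ11, G.σ12, G.c13;
     G.σ12, G.σ22, G.c23;
     G.c13, G.c23, G.c33]

/-- The entry `(1, 1)` of `γ`. -/
noncomputable def γ11 : ℝ :=
  G.a ^ 2 / 4 * (2 * G.p * (1 - G.p) + 9 / 4 * (G.s 0 0 + G.s 1 0 - G.s 0 1 - G.s 1 1)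
    - 3 * G.p * (G.u 0 0 + G.u 1 0))

/-- The entry `(2, 2)` of `γ`. -/
noncomputable def γ22 : ℝ :=
  3 * G.a ^ 2 / 16 * ((G.u 0 0 + G.u 1 0 - G.u 0 1 - G.u 1 1)
    - (G.v 0 0 ^ 2 + G.v 1 0 ^ 2 - G.v 0 1 ^ 2 - G.v 1 1 ^ 2))

/-- The entry `(1, 2)` of `γ`. -/
noncomputable def γ12 : ℝ :=
  G.a ^ 2 * √3 / 16 * (3 * (G.t 0 0 + G.t 1 0 - G.t 0 1 - G.t 1 1)
    + 2 * G.p * (G.v 0 0 + G.v 1 0))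

/-- The matrix `γ`. -/
noncomputable def gamma : Matrix (Fin 3) (Fin 3) ℝ :=
  !![G.γ11, G.γ12, G.c13;
     G.γ12, G.γ22, G.c23;
     G.c13, G.c23, G.c33]

/-- The entry `(1, 1)` of `δ`. -/
noncomputable def δ11 : ℝ :=
  G.a ^ 2 / 4 * (9 / 4 * (G.s 0 0 - G.s 1 0 - G.s 0 1 + G.s 1 1)
    - 3 * G.p * (G.u 0 0 - G.u 1 0))

/-- The entry `(2, 2)` of `δ`. -/
noncomputable def δ22 : ℝ :=
  3 * G.a ^ 2 / 16 * ((G.u 0 0 - G.u 1 0 - G.u 0 1 + G.u 1 1)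
    - (G.v 0 0 ^ 2 - G.v 1 0 ^ 2 - G.v 0 1 ^ 2 + G.v 1 1 ^ 2))

/-- The entry `(1, 2)` of `δ`. -/
noncomputable def δ12 : ℝ :=
  G.a ^ 2 * √3 / 16 * (3 * (G.t 0 0 - G.t 1 0 - G.t 0 1 + G.t 1 1)
    + 2 * G.p * (G.v 0 0 - G.v 1 0))

/-- The entry `(1, 3)` of `δ`. -/
noncomputable def δ13 : ℝ :=
  G.a * G.h / 8 * (-(4 * G.p * (1 - G.p) * (2 * G.α - 1))
    + 3 * G.p * (2 * G.α - 1) * (G.u 0 0 + G.u 1 0))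

/-- The entry `(2, 3)` of `δ`. -/
noncomputable def δ23 : ℝ :=
  -(G.a * G.h * √3 / 8) * (G.p * (2 * G.α - 1) * (G.v 0 0 + G.v 1 0))

/-- The matrix `δ`. -/
noncomputable def delta : Matrix (Fin 3) (Fin 3) ℝ :=
  !![G.δ11, G.δ12, G.δ13;
     G.δ12, G.δ22, G.δ23;
     G.δ13, G.δ23, 0]

/-- The matrix `x yᵀ`. -/
def outer (x y : E3) : Matrix (Fin 3) (Fin 3) ℝ := Matrix.of fun i j => x i * y j

/-- The limiting covariance matrix `Γ` for `p > 0`. -/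
noncomputable def Gamma : Matrix (Fin 3) (Fin 3) ℝ :=
  G.sigmaSq + (G.p / (2 - G.p)) • G.gamma
    + (2 / (2 - G.p) ^ 2) • (outer (G.ζ - G.p • G.μ) G.m + outer G.m (G.ζ - G.p • G.μ))
    - (4 * G.p / (2 - G.p) ^ 3) • outer G.m G.m
    + (2 / (2 - G.p)) • (outer G.θ G.ρ + outer G.ρ G.θ)
    + (4 / (G.p * (2 - G.p))) • outer G.ρ G.ρ

end Params

end Graphite

/-!
The type of the current vertex is itself a finite Markov chain, and the displacement of a jump
depends only on that type, so the walk is a Markov additive process over a chain with four states: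
each jump switches the colour `i`, a horizontal one also switches `j`. Conditioning on the whole
history one jump at a time (`IsRandomWalk.setIntegral_exp`) turns the characteristic function of
`S n - n • ν` in a direction `t` into the `n`-th iterate of a finite twisted transition operator
`K τ f c = ∑ d, w c d * exp (i τ x c d) * f (N c d)`, with `τ = 1 / √n`, applied to the constant `1`
(`charIter`).

These iterates are controlled by an approximate eigenfunction. If `g` solves the Poisson equation of
the centred drift and `q` that of the second moments, then `f = 1 + iτg - τ²q` satisfies
`K τ f = (1 - τ²V/2) f + O(τ³)`, where `V` is the asymptotic variance in the direction `t`. Since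
`K τ` is a contraction for the supremum norm, `n` steps with `τ = 1 / √n` accumulate an error
`O(1 / √n)`, and the characteristic functions tend to `exp (-V / 2)` (`tendsto_charIter`).

It remains to solve the two Poisson equations. For `p > 0` the chain has the stationary law
proportional to `1` on the types `(i, 0)` and to `1 - p` on the types `(i, 1)`; centring determines
`ν = μ + p / (2 - p) • m`, and solvability of the second equation is exactly the identity
`V = t ⬝ᵥ Γ *ᵥ t`. To check it, `μ`, `m`, `θ`, `ρ`, `ζ`, `σ²` and `γ` are first rewritten in terms of
the means and variances of the jumps from the four types. For `p = 0` only the types `(0, 0)` and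
`(1, 1)` are visited, and the same argument is applied to this closed set. Positive semidefiniteness
comes for free: the limit of characteristic functions has modulus at most one, so `V ≥ 0`. Lévy's
continuity theorem concludes.
-/

namespace Graphite

/-! ### Characteristic functions of finite Markov additive processes -/

/-- The characteristic function at `τ` of the position after `m` steps of a real Markov additive
process started in the state `c`. From the state `c`, the `d`-th transition has probability `w c d`,
moves the position by `x c d`, and leads to the state `N c d`. -/
noncomputable def charIter {C D : Type*} [Fintype D] (w x : C → D → ℝ) (N : C → D → C) (τ : ℝ) :
    ℕ → C → ℂ
  | 0, _ => 1
  | m + 1, c => ∑ d, (w c d : ℂ) * Complex.exp ((τ * x c d : ℝ) * Complex.I) *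
      charIter w x N τ m (N c d)

/-- The approximate eigenfunction `1 + iτg - τ²q`. -/
noncomputable def approxEigen {C : Type*} (g q : C → ℝ) (τ : ℝ) (c : C) : ℂ :=
  1 + (τ * g c : ℝ) * Complex.I - (τ ^ 2 * q c : ℝ)

/-- Second-order Taylor expansion at `τ = 0` of one term of the twisted transition operator applied
to `approxEigen`. -/
lemma exists_norm_exp_mul_sub_le (x g q : ℝ) : ∃ K : ℝ, ∀ τ : ℝ, 0 ≤ τ → τ ≤ 1 →
    ‖Complex.exp ((τ * x : ℝ) * Complex.I) * (1 + (τ * g : ℝ) * Complex.I - (τ ^ 2 * q : ℝ)) -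
      (1 + (τ * (x + g) : ℝ) * Complex.I - (τ ^ 2 * (x ^ 2 / 2 + x * g + q) : ℝ))‖ ≤ K * τ ^ 3 := by
  refine ⟨|x| ^ 3 * Real.exp |x| * (1 + |g| + |q|) + |x * q + x ^ 2 * g / 2| + |x ^ 2 * q / 2|,
    fun τ h0 h1 => ?_⟩
  have hτ2 : τ ^ 2 ≤ 1 := pow_le_one₀ h0 h1
  set y : ℂ := (τ * x : ℝ) * Complex.I with hy
  have hny : ‖y‖ = τ * |x| := by
    rw [hy, norm_mul, Complex.norm_I, mul_one, Complex.norm_real, Real.norm_eq_abs, abs_mul,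
      abs_of_nonneg h0]
  have hy2 : y ^ 2 = -((τ * x : ℝ) : ℂ) ^ 2 := by
    rw [hy, mul_pow, Complex.I_sq]; ring
  have hr : ‖Complex.exp y - (1 + y + y ^ 2 / 2)‖ ≤ τ ^ 3 * (|x| ^ 3 * Real.exp |x|) := by
    have h := Complex.norm_exp_sub_sum_le_norm_mul_exp y 3
    have e : ∑ m ∈ Finset.range 3, y ^ m / (m.factorial : ℂ) = 1 + y + y ^ 2 / 2 := by
      simp [Finset.sum_range_succ, Nat.factorial]
    rw [e, hny] at h
    refine h.trans ?_
    rw [mul_pow, mul_assoc]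
    gcongr
    exact mul_le_of_le_one_left (abs_nonneg x) h1
  have hf : ‖(1 + (τ * g : ℝ) * Complex.I - (τ ^ 2 * q : ℝ) : ℂ)‖ ≤ 1 + |g| + |q| := by
    refine (norm_sub_le _ _).trans ?_
    refine add_le_add ((norm_add_le _ _).trans ?_) ?_
    · rw [norm_one, norm_mul, Complex.norm_I, mul_one, Complex.norm_real, Real.norm_eq_abs, abs_mul,
        abs_of_nonneg h0]
      gcongr
      exact mul_le_of_le_one_left (abs_nonneg g) h1
    · rw [Complex.norm_real, Real.norm_eq_abs, abs_mul, abs_of_nonneg (sq_nonneg τ)]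
      exact mul_le_of_le_one_left (abs_nonneg q) hτ2
  have key : Complex.exp y * (1 + (τ * g : ℝ) * Complex.I - (τ ^ 2 * q : ℝ)) -
      (1 + (τ * (x + g) : ℝ) * Complex.I - (τ ^ 2 * (x ^ 2 / 2 + x * g + q) : ℝ)) =
      (Complex.exp y - (1 + y + y ^ 2 / 2)) * (1 + (τ * g : ℝ) * Complex.I - (τ ^ 2 * q : ℝ))
      - ((τ ^ 3 * (x * q + x ^ 2 * g / 2) : ℝ) : ℂ) * Complex.I
      + ((τ ^ 3 * τ * (x ^ 2 * q / 2) : ℝ) : ℂ) := by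
    rw [hy2]
    simp only [hy]
    push_cast
    linear_combination (τ ^ 2 * x * g : ℂ) * Complex.I_sq
  rw [key]
  have h3 : 0 ≤ τ ^ 3 := by positivity
  refine (norm_add_le _ _).trans ((add_le_add ((norm_sub_le _ _).trans
    (add_le_add (norm_mul_le _ _) le_rfl)) le_rfl).trans ?_)
  rw [norm_mul _ Complex.I, Complex.norm_I, mul_one, Complex.norm_real, Complex.norm_real,
    Real.norm_eq_abs, Real.norm_eq_abs, abs_mul (τ ^ 3), abs_mul (τ ^ 3 * τ), abs_of_nonneg h3,
    abs_of_nonneg (mul_nonneg h3 h0)]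
  have a1 := mul_le_mul hr hf (norm_nonneg _) (by positivity)
  have a2 : τ ^ 3 * τ * |x ^ 2 * q / 2| ≤ τ ^ 3 * |x ^ 2 * q / 2| := by
    gcongr
    exact mul_le_of_le_one_right h3 h1
  nlinarith [a1, a2]

section Markov

variable {C D : Type*} [Fintype D] {w x : C → D → ℝ} {N : C → D → C}

/-- If `g` solves the Poisson equation of the drift and `q` that of the second moments, then
`1 + iτg - τ²q` is an eigenfunction of the transition operator twisted by `exp (iτx)`, with
eigenvalue `1 - τ²V/2`, up to an error of order `τ³`. -/
lemma exists_norm_approxEigen_le {g q : C → ℝ} {V : ℝ} {c : C}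
    (hw : ∀ d, 0 ≤ w c d) (hw1 : ∑ d, w c d = 1)
    (hg : ∑ d, w c d * (x c d + g (N c d)) = g c)
    (hq : ∑ d, w c d * (x c d ^ 2 / 2 + x c d * g (N c d) + q (N c d)) = q c + V / 2) :
    ∃ K : ℝ, ∀ τ : ℝ, 0 ≤ τ → τ ≤ 1 →
      ‖∑ d, (w c d : ℂ) * Complex.exp ((τ * x c d : ℝ) * Complex.I) * approxEigen g q τ (N c d) -
        (1 - τ ^ 2 * (V / 2) : ℝ) * approxEigen g q τ c‖ ≤ K * τ ^ 3 := by
  choose K hK using fun d => exists_norm_exp_mul_sub_le (x c d) (g (N c d)) (q (N c d))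
  refine ⟨∑ d, w c d * K d + |V / 2 * g c| + |V / 2 * q c|, fun τ h0 h1 => ?_⟩
  have h3 : 0 ≤ τ ^ 3 := by positivity
  have e1 : ∑ d, (w c d : ℂ) * (1 + (τ * (x c d + g (N c d)) : ℝ) * Complex.I -
      (τ ^ 2 * (x c d ^ 2 / 2 + x c d * g (N c d) + q (N c d)) : ℝ)) =
      1 + (τ * g c : ℝ) * Complex.I - (τ ^ 2 * (q c + V / 2) : ℝ) := by
    have : (1 + (τ * g c : ℝ) * Complex.I - (τ ^ 2 * (q c + V / 2) : ℝ) : ℂ) =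
        ((∑ d, w c d : ℝ) : ℂ) + (τ * g c : ℝ) * Complex.I - (τ ^ 2 * (q c + V / 2) : ℝ) := by
      rw [hw1, Complex.ofReal_one]
    rw [this, ← hg, ← hq]
    push_cast
    simp only [Finset.mul_sum, Finset.sum_mul, ← Finset.sum_add_distrib, ← Finset.sum_sub_distrib]
    refine Finset.sum_congr rfl fun d _ => ?_
    ring
  have key : ∑ d, (w c d : ℂ) * Complex.exp ((τ * x c d : ℝ) * Complex.I) *
        approxEigen g q τ (N c d) - (1 - τ ^ 2 * (V / 2) : ℝ) * approxEigen g q τ c =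
      ∑ d, (w c d : ℂ) * (Complex.exp ((τ * x c d : ℝ) * Complex.I) * approxEigen g q τ (N c d) -
        (1 + (τ * (x c d + g (N c d)) : ℝ) * Complex.I -
          (τ ^ 2 * (x c d ^ 2 / 2 + x c d * g (N c d) + q (N c d)) : ℝ)))
      + ((τ ^ 3 * (V / 2 * g c) : ℝ) * Complex.I - (τ ^ 3 * τ * (V / 2 * q c) : ℝ)) := by
    simp only [mul_sub (w c _ : ℂ), Finset.sum_sub_distrib, ← mul_assoc (w c _ : ℂ)] at e1 ⊢
    rw [e1]
    simp only [approxEigen]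
    push_cast
    ring
  rw [key, add_assoc, add_mul]
  refine (norm_add_le _ _).trans (add_le_add ((norm_sum_le _ _).trans ?_)
    ((norm_sub_le _ _).trans ?_))
  · rw [Finset.sum_mul]
    refine Finset.sum_le_sum fun d _ => ?_
    rw [norm_mul, Complex.norm_real, Real.norm_eq_abs, abs_of_nonneg (hw d), mul_assoc]
    exact mul_le_mul_of_nonneg_left (hK d τ h0 h1) (hw d)
  · rw [norm_mul _ Complex.I, Complex.norm_I, mul_one, Complex.norm_real, Complex.norm_real,
      Real.norm_eq_abs, Real.norm_eq_abs, abs_mul (τ ^ 3), abs_mul (τ ^ 3 * τ), abs_of_nonneg h3,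
      abs_of_nonneg (mul_nonneg h3 h0)]
    have a2 : τ ^ 3 * τ * |V / 2 * q c| ≤ τ ^ 3 * |V / 2 * q c| := by
      gcongr
      exact mul_le_of_le_one_right h3 h1
    nlinarith [a2]

lemma norm_approxEigen_sub_one_le (g q : C → ℝ) (c : C) {τ : ℝ} (h0 : 0 ≤ τ) (h1 : τ ≤ 1) :
    ‖approxEigen g q τ c - 1‖ ≤ (|g c| + |q c|) * τ := by
  have : approxEigen g q τ c - 1 = (τ * g c : ℝ) * Complex.I - (τ ^ 2 * q c : ℝ) := by
    rw [approxEigen]; ring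
  rw [this]
  refine (norm_sub_le _ _).trans ?_
  rw [norm_mul _ Complex.I, Complex.norm_I, mul_one, Complex.norm_real, Complex.norm_real,
    Real.norm_eq_abs, Real.norm_eq_abs, abs_mul, abs_mul, abs_of_nonneg h0,
    abs_of_nonneg (sq_nonneg τ)]
  nlinarith [mul_le_mul_of_nonneg_right (pow_le_of_le_one h0 h1 two_ne_zero) (abs_nonneg (q c))]

variable [Finite C]

/-- Central limit theorem for a finite Markov additive process whose Poisson equations are solved
by `g` and `q` on a set `T` of states closed under the transitions. -/
theorem tendsto_charIter (T : Set C) {g q : C → ℝ} {V : ℝ}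
    (hT : ∀ c ∈ T, ∀ d, w c d ≠ 0 → N c d ∈ T)
    (hw : ∀ c ∈ T, ∀ d, 0 ≤ w c d) (hw1 : ∀ c ∈ T, ∑ d, w c d = 1)
    (hg : ∀ c ∈ T, ∑ d, w c d * (x c d + g (N c d)) = g c)
    (hq : ∀ c ∈ T, ∑ d, w c d * (x c d ^ 2 / 2 + x c d * g (N c d) + q (N c d)) = q c + V / 2)
    {c : C} (hc : c ∈ T) :
    Tendsto (fun n : ℕ => charIter w x N (√(n : ℝ))⁻¹ n c) atTop
      (𝓝 (Complex.exp (-(V / 2 : ℝ)))) := by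
  classical
  have := Fintype.ofFinite C
  -- Uniform constants for the one-step error and for the initial error.
  obtain ⟨K, hK0, hK⟩ : ∃ K : ℝ, 0 ≤ K ∧ ∀ c ∈ T, ∀ τ : ℝ, 0 ≤ τ → τ ≤ 1 →
      ‖∑ d, (w c d : ℂ) * Complex.exp ((τ * x c d : ℝ) * Complex.I) * approxEigen g q τ (N c d) -
        (1 - τ ^ 2 * (V / 2) : ℝ) * approxEigen g q τ c‖ ≤ K * τ ^ 3 := by
    have h : ∀ c, ∃ K : ℝ, c ∈ T → ∀ τ : ℝ, 0 ≤ τ → τ ≤ 1 →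
        ‖∑ d, (w c d : ℂ) * Complex.exp ((τ * x c d : ℝ) * Complex.I) *
          approxEigen g q τ (N c d) -
          (1 - τ ^ 2 * (V / 2) : ℝ) * approxEigen g q τ c‖ ≤ K * τ ^ 3 := by
      intro c
      by_cases h : c ∈ T
      · obtain ⟨K, hK⟩ := exists_norm_approxEigen_le (hw c h) (hw1 c h) (hg c h) (hq c h)
        exact ⟨K, fun _ => hK⟩
      · exact ⟨0, fun h' => absurd h' h⟩
    choose K hK using h
    refine ⟨∑ c, |K c|, Finset.sum_nonneg fun _ _ => abs_nonneg _, fun c hc τ h0 h1 =>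
      (hK c hc τ h0 h1).trans ?_⟩
    gcongr
    exact (le_abs_self _).trans
      (Finset.single_le_sum (f := fun c => |K c|) (fun _ _ => abs_nonneg _) (Finset.mem_univ c))
  obtain ⟨B, hB⟩ : ∃ B : ℝ, ∀ c, |g c| + |q c| ≤ B :=
    ⟨∑ c, (|g c| + |q c|), fun c => Finset.single_le_sum (f := fun c => |g c| + |q c|)
      (fun _ _ => by positivity) (Finset.mem_univ c)⟩
  have hstart : ∀ c, ∀ τ : ℝ, 0 ≤ τ → τ ≤ 1 → ‖approxEigen g q τ c - 1‖ ≤ B * τ :=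
    fun c τ h0 h1 => (norm_approxEigen_sub_one_le g q c h0 h1).trans
      (mul_le_mul_of_nonneg_right (hB c) h0)
  -- The twisted operator is a contraction, so the one-step errors add up.
  have herr : ∀ τ : ℝ, 0 ≤ τ → τ ≤ 1 → ∀ m : ℕ, ∀ c ∈ T,
      ‖charIter w x N τ m c - ((1 - τ ^ 2 * (V / 2) : ℝ) : ℂ) ^ m * approxEigen g q τ c‖ ≤
        B * τ + m * (K * τ ^ 3 * (1 + τ ^ 2 * |V / 2|) ^ m) := by
    intro τ h0 h1 m
    have hl : ‖((1 - τ ^ 2 * (V / 2) : ℝ) : ℂ)‖ ≤ 1 + τ ^ 2 * |V / 2| := by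
      rw [Complex.norm_real]
      refine (norm_sub_le _ _).trans ?_
      rw [norm_one, Real.norm_eq_abs, abs_mul, abs_of_nonneg (sq_nonneg τ)]
    have hl1 : 1 ≤ 1 + τ ^ 2 * |V / 2| := le_add_of_nonneg_right (by positivity)
    induction m with
    | zero =>
      intro c _
      rw [norm_sub_rev]
      simpa [charIter] using hstart c τ h0 h1
    | succ m ih =>
      intro c hc
      set l : ℂ := ((1 - τ ^ 2 * (V / 2) : ℝ) : ℂ)
      set L : ℝ := 1 + τ ^ 2 * |V / 2|
      have e : charIter w x N τ (m + 1) c - l ^ (m + 1) * approxEigen g q τ c =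
          ∑ d, (w c d : ℂ) * Complex.exp ((τ * x c d : ℝ) * Complex.I) *
            (charIter w x N τ m (N c d) - l ^ m * approxEigen g q τ (N c d)) +
          l ^ m * (∑ d, (w c d : ℂ) * Complex.exp ((τ * x c d : ℝ) * Complex.I) *
            approxEigen g q τ (N c d) - l * approxEigen g q τ c) := by
        rw [charIter, mul_sub, Finset.mul_sum]
        simp only [mul_sub, Finset.sum_sub_distrib]
        have : ∀ d, (w c d : ℂ) * Complex.exp ((τ * x c d : ℝ) * Complex.I) *
            (l ^ m * approxEigen g q τ (N c d)) =
            l ^ m * ((w c d : ℂ) * Complex.exp ((τ * x c d : ℝ) * Complex.I) *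
              approxEigen g q τ (N c d)) := fun d => by ring
        simp only [this]
        ring
      rw [e]
      have s1 : ‖∑ d, (w c d : ℂ) * Complex.exp ((τ * x c d : ℝ) * Complex.I) *
            (charIter w x N τ m (N c d) - l ^ m * approxEigen g q τ (N c d))‖ ≤
          B * τ + m * (K * τ ^ 3 * L ^ m) := by
        calc _ ≤ ∑ d, w c d * (B * τ + m * (K * τ ^ 3 * L ^ m)) := by
              refine (norm_sum_le _ _).trans (Finset.sum_le_sum fun d _ => ?_)
              rw [norm_mul, norm_mul, Complex.norm_exp_ofReal_mul_I, mul_one, Complex.norm_real,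
                Real.norm_eq_abs, abs_of_nonneg (hw c hc d)]
              by_cases hd : w c d = 0
              · simp [hd]
              · exact mul_le_mul_of_nonneg_left (ih _ (hT c hc d hd)) (hw c hc d)
          _ = _ := by rw [← Finset.sum_mul, hw1 c hc, one_mul]
      have s2 : ‖l ^ m * (∑ d, (w c d : ℂ) * Complex.exp ((τ * x c d : ℝ) * Complex.I) *
            approxEigen g q τ (N c d) - l * approxEigen g q τ c)‖ ≤ L ^ m * (K * τ ^ 3) := by
        rw [norm_mul, norm_pow]
        gcongr
        exact hK c hc τ h0 h1
      have hLL : L ^ m ≤ L ^ (m + 1) := pow_le_pow_right₀ hl1 (Nat.le_succ m)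
      refine (norm_add_le _ _).trans ((add_le_add s1 s2).trans ?_)
      push_cast
      have : (m + 1 : ℝ) * (K * τ ^ 3 * L ^ m) ≤ (m + 1) * (K * τ ^ 3 * L ^ (m + 1)) := by
        gcongr
      linarith
  have hsqrt : Tendsto (fun n : ℕ => (√(n : ℝ))⁻¹) atTop (𝓝 0) :=
    tendsto_inv_atTop_zero.comp (Real.tendsto_sqrt_atTop.comp tendsto_natCast_atTop_atTop)
  have hmain : Tendsto (fun n : ℕ => ((1 - (√(n : ℝ))⁻¹ ^ 2 * (V / 2) : ℝ) : ℂ) ^ n *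
      approxEigen g q (√(n : ℝ))⁻¹ c) atTop (𝓝 (Complex.exp (-(V / 2 : ℝ)))) := by
    have t1 : Tendsto (fun n : ℕ => ((1 - (√(n : ℝ))⁻¹ ^ 2 * (V / 2) : ℝ) : ℂ) ^ n) atTop
        (𝓝 (Complex.exp (-(V / 2 : ℝ)))) := by
      have := (Complex.continuous_ofReal.tendsto _).comp
        (Real.tendsto_one_add_div_pow_exp (-(V / 2)))
      rw [Complex.ofReal_exp, Complex.ofReal_neg] at this
      refine this.congr fun n => ?_
      simp only [Function.comp_apply, Complex.ofReal_pow]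
      congr 2
      rw [inv_pow, Real.sq_sqrt (Nat.cast_nonneg n)]
      ring
    have t2 : Tendsto (fun n : ℕ => approxEigen g q (√(n : ℝ))⁻¹ c) atTop (𝓝 1) := by
      have : Continuous fun τ : ℝ => approxEigen g q τ c := by
        unfold approxEigen
        fun_prop
      have h := (this.tendsto 0).comp hsqrt
      have h0 : approxEigen g q 0 c = 1 := by simp [approxEigen]
      rwa [h0] at h
    simpa using t1.mul t2
  have hbound : Tendsto (fun n : ℕ => B * (√(n : ℝ))⁻¹ +
      K * (√(n : ℝ))⁻¹ * Real.exp |V / 2|) atTop (𝓝 0) := by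
    simpa using (hsqrt.const_mul B).add ((hsqrt.const_mul K).mul_const (Real.exp |V / 2|))
  have hdiff : Tendsto (fun n : ℕ => charIter w x N (√(n : ℝ))⁻¹ n c -
      ((1 - (√(n : ℝ))⁻¹ ^ 2 * (V / 2) : ℝ) : ℂ) ^ n * approxEigen g q (√(n : ℝ))⁻¹ c)
      atTop (𝓝 0) := by
    refine squeeze_zero_norm' ?_ hbound
    filter_upwards [eventually_ge_atTop 1] with n hn
    have hn1 : (1 : ℝ) ≤ n := by exact_mod_cast hn
    have h1 : (√(n : ℝ))⁻¹ ≤ 1 := inv_le_one_of_one_le₀ (Real.one_le_sqrt.2 hn1)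
    have hsq : (√(n : ℝ))⁻¹ ^ 2 = (n : ℝ)⁻¹ := by rw [inv_pow, Real.sq_sqrt (by linarith)]
    refine (herr _ (by positivity) h1 n c hc).trans (add_le_add le_rfl ?_)
    -- The eigenvalue may exceed `1` in modulus, since the sign of `V` is not known here; its first
    -- `n` powers stay bounded because `τ ^ 2 * n = 1`.
    have hexp : (1 + (√(n : ℝ))⁻¹ ^ 2 * |V / 2|) ^ n ≤ Real.exp |V / 2| := by
      rw [hsq]
      calc (1 + (n : ℝ)⁻¹ * |V / 2|) ^ n ≤ Real.exp ((n : ℝ)⁻¹ * |V / 2|) ^ n := by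
            gcongr
            linarith [Real.add_one_le_exp ((n : ℝ)⁻¹ * |V / 2|)]
        _ = Real.exp |V / 2| := by
            rw [← Real.exp_nat_mul]
            congr 1
            field_simp
    have e : (n : ℝ) * (K * (√(n : ℝ))⁻¹ ^ 3 * (1 + (√(n : ℝ))⁻¹ ^ 2 * |V / 2|) ^ n) =
        K * (√(n : ℝ))⁻¹ * (1 + (√(n : ℝ))⁻¹ ^ 2 * |V / 2|) ^ n := by
      rw [pow_succ _ 2, hsq]
      field_simp
    rw [e]
    gcongr
  simpa using hdiff.add hmain

end Markov

namespace Params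

/-! ### Jumps of the walk and types of the vertices -/

/-- The transition probabilities of the walk from a vertex of type `c`. The jumps are indexed by
`Fin 3 ⊕ Fin 2`: the three horizontal ones, then the upward and the downward one. -/
def weight (G : Params) (c : Fin 2 × Fin 2) : Fin 3 ⊕ Fin 2 → ℝ :=
  Sum.elim (G.prob c.1 c.2) (if c.2 = 0 then ![G.α * G.p, (1 - G.α) * G.p] else 0)

/-- The displacements of the walk from a vertex of type `c`. -/
noncomputable def jump (G : Params) (c : Fin 2 × Fin 2) : Fin 3 ⊕ Fin 2 → E3 :=
  Sum.elim (G.step c.1) ![G.up, -G.up]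

/-- The type of the vertex reached from a vertex of type `c`: each jump switches the colour, and
horizontal ones also switch the second index. The value for a vertical jump from a vertex which
does not allow it is irrelevant. -/
def next (c : Fin 2 × Fin 2) : Fin 3 ⊕ Fin 2 → Fin 2 × Fin 2 :=
  Sum.elim (fun _ => (1 - c.1, 1 - c.2)) (fun _ => (1 - c.1, c.2))

variable (G : Params)

lemma weight_nonneg (c : Fin 2 × Fin 2) (d : Fin 3 ⊕ Fin 2) : 0 ≤ G.weight c d := by
  rcases c with ⟨i, j⟩
  rcases d with k | k
  · exact G.prob_nonneg i j k
  · have h1 : 0 ≤ G.α * G.p := mul_nonneg G.α_pos.le G.p_nonneg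
    have h2 : 0 ≤ (1 - G.α) * G.p := mul_nonneg (by linarith [G.α_lt_one]) G.p_nonneg
    by_cases hj : j = 0
    · fin_cases k <;> simpa [weight, hj]
    · simp [weight, hj]

lemma sum_weight (c : Fin 2 × Fin 2) : ∑ d, G.weight c d = 1 := by
  rcases c with ⟨i, j⟩
  rw [Fintype.sum_sum_type]
  fin_cases j
  · simp [weight, Fin.sum_univ_two, G.sum_prob_zero]
    ring
  · simp [weight, G.sum_prob_one]

/-- The horizontal jumps in algebraic form; a half-turn accounts for the colour. -/
lemma step_eq (i : Fin 2) (k : Fin 3) : G.step i k =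
    !₂[(-1) ^ (i : ℕ) * (G.a * ![1, -1 / 2, -1 / 2] k),
      (-1) ^ (i : ℕ) * (G.a * (√3 / 2 * ![0, 1, -1] k)), 0] := by
  have c1 : Real.cos (2 / 3 * Real.pi) = -1 / 2 := by
    rw [show 2 / 3 * Real.pi = Real.pi - Real.pi / 3 by ring, Real.cos_pi_sub, Real.cos_pi_div_three]
    norm_num
  have s1 : Real.sin (2 / 3 * Real.pi) = √3 / 2 := by
    rw [show 2 / 3 * Real.pi = Real.pi - Real.pi / 3 by ring, Real.sin_pi_sub, Real.sin_pi_div_three]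
  have c2 : Real.cos (2 / 3 * 2 * Real.pi) = -1 / 2 := by
    rw [show 2 / 3 * 2 * Real.pi = Real.pi / 3 + Real.pi by ring, Real.cos_add_pi,
      Real.cos_pi_div_three]
    norm_num
  have s2 : Real.sin (2 / 3 * 2 * Real.pi) = -(√3 / 2) := by
    rw [show 2 / 3 * 2 * Real.pi = Real.pi / 3 + Real.pi by ring, Real.sin_add_pi,
      Real.sin_pi_div_three]
  have hc : Real.cos (2 / 3 * ((k : ℕ) : ℝ) * Real.pi) = ![1, -1 / 2, -1 / 2] k := by
    fin_cases k <;> simp [c1, c2]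
  have hs : Real.sin (2 / 3 * ((k : ℕ) : ℝ) * Real.pi) = √3 / 2 * ![0, 1, -1] k := by
    fin_cases k <;> simp [s1, s2]
  rw [step, Real.cos_add_nat_mul_pi, Real.sin_add_nat_mul_pi, hc, hs,
    mul_left_comm G.a ((-1) ^ (i : ℕ)), mul_left_comm G.a ((-1) ^ (i : ℕ))]

/-- Distinct jumps lead to distinct vertices, so that they are disjoint events. -/
lemma jump_injective (c : Fin 2 × Fin 2) : Function.Injective (G.jump c) := by
  have ha := G.a_pos
  have hh := G.h_pos
  have hsgn : ((-1 : ℝ) ^ (c.1 : ℕ)) ≠ 0 := by simp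
  have hstep : ∀ k, (G.step c.1 k) 2 = 0 := fun k => by simp [step_eq]
  intro d d' h
  rcases d with k | k <;> rcases d' with k' | k'
  · congr 1
    have h0 := congrArg (fun x : E3 => x 0) h
    have h1 := congrArg (fun x : E3 => x 1) h
    simp only [jump, Sum.elim_inl, step_eq] at h0 h1
    simp [hsgn, ha.ne'] at h0 h1
    fin_cases k <;> fin_cases k' <;>
      first | rfl | (exfalso; norm_num at h0; done) | (exfalso; norm_num at h1)
  · have h2 := congrArg (fun x : E3 => x 2) h
    simp only [jump, Sum.elim_inl, Sum.elim_inr, hstep] at h2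
    fin_cases k' <;> simp [up, hh.ne'] at h2
    exact absurd h2 hh.ne
  · have h2 := congrArg (fun x : E3 => x 2) h
    simp only [jump, Sum.elim_inl, Sum.elim_inr, hstep] at h2
    fin_cases k <;> simp [up] at h2 <;> exact absurd h2 hh.ne'
  · congr 1
    have h2 := congrArg (fun x : E3 => x 2) h
    simp only [jump, Sum.elim_inr] at h2
    fin_cases k <;> fin_cases k' <;> simp [up] at h2 ⊢ <;> linarith

lemma add_jump_mem_vertices {c : Fin 2 × Fin 2} {d : Fin 3 ⊕ Fin 2} (hd : G.weight c d ≠ 0)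
    {x : E3} (hx : x ∈ G.vertices c.1 c.2) :
    x + G.jump c d ∈ G.vertices (next c d).1 (next c d).2 := by
  obtain ⟨i, j⟩ := c
  obtain ⟨k, l, n, rfl⟩ := hx
  rcases d with e | e
  · refine ⟨k - (-1) ^ (i : ℕ) * ![0, 1, 1] e, l + (-1) ^ (i : ℕ) * ![0, 1, 0] e, n, ?_⟩
    simp only [jump, next, Sum.elim_inl, step_eq]
    ext t
    fin_cases i <;> fin_cases j <;> fin_cases e <;> fin_cases t <;> simp <;> ring
  · have hj : j = 0 := by
      by_contra hj
      simp [weight, hj] at hd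
    subst hj
    refine ⟨k, l, n + ![![0, -1], ![1, 0]] i e, ?_⟩
    simp only [jump, next, Sum.elim_inr]
    ext t
    fin_cases i <;> fin_cases e <;> fin_cases t <;> simp [up] <;> ring

lemma zero_mem_vertices : (0 : E3) ∈ G.vertices 0 0 := by
  refine ⟨0, 0, 0, ?_⟩
  ext t
  fin_cases t <;> simp

/-! ### The characteristic function of the walk -/

section Walk

variable {G} {Ω : Type*} [MeasurableSpace Ω] {P : Measure Ω} {S : ℕ → Ω → E3}

lemma measurableSet_history (hS : ∀ n, Measurable (S n)) (x : ℕ → E3) (n : ℕ) :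
    MeasurableSet (history S x n) := by
  have : history S x n = ⋂ k, ⋂ (_ : k ≤ n), S k ⁻¹' {x k} := by
    ext ω; simp [history]
  rw [this]
  exact .iInter fun k => .iInter fun _ => hS k (measurableSet_singleton _)

/-- The path `x` up to time `n`, followed by a jump to `x n + y`. -/
noncomputable def extend (x : ℕ → E3) (n : ℕ) (y : E3) : ℕ → E3 :=
  Function.update x (n + 1) (x n + y)

lemma extend_succ (x : ℕ → E3) (n : ℕ) (y : E3) : extend x n y (n + 1) = x n + y := by
  simp [extend]

omit [MeasurableSpace Ω] in
lemma history_extend (x : ℕ → E3) (n : ℕ) (y : E3) :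
    history S (extend x n y) (n + 1) = history S x n ∩ {ω | S (n + 1) ω = x n + y} := by
  ext ω
  simp only [history, extend, Set.mem_ofPred_eq, Set.mem_inter_iff]
  constructor
  · intro h
    refine ⟨fun k hk => ?_, by simpa using h (n + 1) le_rfl⟩
    have := h k (by omega)
    rwa [Function.update_of_ne (by omega)] at this
  · rintro ⟨h, h'⟩ k hk
    rcases Nat.lt_or_ge n k with hk' | hk'
    · obtain rfl : k = n + 1 := by omega
      simpa using h'
    · rw [Function.update_of_ne (by omega)]
      exact h k hk'

lemma IsRandomWalk.real_history_extend [IsProbabilityMeasure P] (hS : G.IsRandomWalk P S)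
    {c : Fin 2 × Fin 2} {n : ℕ} {x : ℕ → E3} (hx : x n ∈ G.vertices c.1 c.2)
    {d : Fin 3 ⊕ Fin 2} (hd : G.weight c d ≠ 0) :
    P.real (history S (extend x n (G.jump c d)) (n + 1)) =
      P.real (history S x n) * G.weight c d := by
  have hm := measurableSet_history hS.measurable x n
  rw [history_extend]
  by_cases h0 : P (history S x n) = 0
  · have h1 : P.real (history S x n) = 0 := by simp [measureReal_def, h0]
    rw [h1, zero_mul]
    simp [measureReal_def, measure_mono_null Set.inter_subset_left h0]
  obtain ⟨i, j⟩ := c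
  -- A jump of positive probability is horizontal, or vertical from a vertex which allows it.
  have key : (P[|history S x n]).real {ω | S (n + 1) ω = x n + G.jump (i, j) d} =
      G.weight (i, j) d := by
    rcases d with k | k
    · exact hS.jump_horizontal i j k n x hx h0
    · have hj : j = 0 := by
        by_contra hj
        simp [weight, hj] at hd
      subst hj
      fin_cases k
      · exact hS.jump_up i n x hx h0
      · simpa [jump, weight, sub_eq_add_neg] using hS.jump_down i n x hx h0
  rw [← key, measureReal_def, measureReal_def, measureReal_def, cond_apply hm, ENNReal.toReal_mul,
    ENNReal.toReal_inv, mul_inv_cancel_left₀]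
  exact (ENNReal.toReal_pos h0 (measure_ne_top _ _)).ne'

/-- Up to a null set, the event that the path of the walk starts with `x` is the disjoint union of
the events that it then makes one of the jumps of positive probability. -/
lemma IsRandomWalk.setIntegral_history [IsProbabilityMeasure P] (hS : G.IsRandomWalk P S)
    {c : Fin 2 × Fin 2} {n : ℕ} {x : ℕ → E3} (hx : x n ∈ G.vertices c.1 c.2)
    {F : Ω → ℂ} (hF : Integrable F P) :
    ∫ ω in history S x n, F ω ∂P =
      ∑ d with G.weight c d ≠ 0, ∫ ω in history S (extend x n (G.jump c d)) (n + 1), F ω ∂P := by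
  have hm := measurableSet_history hS.measurable
  set D : Finset (Fin 3 ⊕ Fin 2) := {d | G.weight c d ≠ 0} with hD
  set A : Fin 3 ⊕ Fin 2 → Set Ω := fun d => history S (extend x n (G.jump c d)) (n + 1) with hA
  have hdisj : (D : Set (Fin 3 ⊕ Fin 2)).PairwiseDisjoint A := by
    intro d _ d' _ hdd
    refine Set.disjoint_left.2 fun ω h h' => hdd (G.jump_injective c ?_)
    simp only [hA, history_extend] at h h'
    exact add_left_cancel (h.2.symm.trans h'.2)
  have hAm : ∀ d ∈ D, MeasurableSet (A d) := fun d _ => hm _ _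
  have hsub : ⋃ d ∈ D, A d ⊆ history S x n := by
    refine Set.iUnion₂_subset fun d _ => ?_
    simp only [hA, history_extend]
    exact Set.inter_subset_left
  have hsum : ∑ d ∈ D, G.weight c d = 1 := by
    rw [← G.sum_weight c, hD, Finset.sum_filter_ne_zero]
  have hreal : P.real (⋃ d ∈ D, A d) = P.real (history S x n) := by
    rw [measureReal_biUnion_finset hdisj hAm, Finset.sum_congr rfl fun d hd =>
      hS.real_history_extend hx (by simpa [hD] using hd), ← Finset.mul_sum, hsum, mul_one]
  -- The jumps of positive probability exhaust the mass of the history.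
  have hae : (⋃ d ∈ D, A d : Set Ω) =ᵐ[P] history S x n := by
    refine ae_eq_of_subset_of_measure_ge hsub ?_ (Finset.measurableSet_biUnion D hAm).nullMeasurableSet
      (measure_ne_top _ _)
    exact ((ENNReal.toReal_eq_toReal_iff' (measure_ne_top _ _) (measure_ne_top _ _)).1 hreal).ge
  rw [← setIntegral_congr_set hae, integral_biUnion_finset D hAm hdisj]
  exact fun d _ => hF.integrableOn

/-- The characteristic function of the increments of the walk, given its path up to time `n`. -/
lemma IsRandomWalk.setIntegral_exp [IsProbabilityMeasure P] (hS : G.IsRandomWalk P S)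
    (t : E3) (b τ : ℝ) (m : ℕ) :
    ∀ (c : Fin 2 × Fin 2) (n : ℕ) (x : ℕ → E3), x n ∈ G.vertices c.1 c.2 →
      ∫ ω in history S x n,
        Complex.exp ((τ * (inner ℝ (S (n + m) ω) t - m * b) : ℝ) * Complex.I) ∂P =
      P.real (history S x n) * Complex.exp ((τ * inner ℝ (x n) t : ℝ) * Complex.I) *
        charIter G.weight (fun c d => inner ℝ (G.jump c d) t - b) next τ m c := by
  have hm := measurableSet_history hS.measurable
  induction m with
  | zero =>
    intro c n x hx
    have : ∫ ω in history S x n,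
        Complex.exp ((τ * (inner ℝ (S (n + 0) ω) t - (0 : ℕ) * b) : ℝ) * Complex.I) ∂P =
        ∫ ω in history S x n, Complex.exp ((τ * inner ℝ (x n) t : ℝ) * Complex.I) ∂P := by
      refine setIntegral_congr_fun (hm x n) fun ω hω => ?_
      simp [hω n le_rfl]
    rw [this, setIntegral_const, charIter, mul_one, Complex.real_smul]
  | succ m ih =>
    intro c n x hx
    rw [hS.setIntegral_history hx]
    · rw [charIter, Finset.mul_sum, Finset.sum_filter]
      refine Finset.sum_congr rfl fun d _ => ?_
      by_cases hd : G.weight c d = 0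
      · simp [hd]
      have hmem := G.add_jump_mem_vertices hd hx
      rw [← extend_succ] at hmem
      have := ih (next c d) (n + 1) _ hmem
      rw [extend_succ, hS.real_history_extend hx hd] at this
      rw [if_pos hd]
      have e : ∀ ω, Complex.exp ((τ * (inner ℝ (S (n + (m + 1)) ω) t - (m + 1 : ℕ) * b) : ℝ) *
          Complex.I) = Complex.exp ((-(τ * b) : ℝ) * Complex.I) *
          Complex.exp ((τ * (inner ℝ (S (n + 1 + m) ω) t - m * b) : ℝ) * Complex.I) := fun ω => by
        rw [← Complex.exp_add, show n + (m + 1) = n + 1 + m by ring]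
        congr 1
        push_cast
        ring
      have e' : Complex.exp ((τ * inner ℝ (x n + G.jump c d) t : ℝ) * Complex.I) =
          Complex.exp ((τ * b : ℝ) * Complex.I) *
          (Complex.exp ((τ * inner ℝ (x n) t : ℝ) * Complex.I) *
          Complex.exp ((τ * (inner ℝ (G.jump c d) t - b) : ℝ) * Complex.I)) := by
        rw [← Complex.exp_add, ← Complex.exp_add, inner_add_left]
        congr 1
        push_cast
        ring
      have e'' : Complex.exp ((-(τ * b) : ℝ) * Complex.I) * Complex.exp ((τ * b : ℝ) * Complex.I) =
          1 := by
        rw [← Complex.exp_add, ← Complex.exp_zero]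
        congr 1
        push_cast
        ring
      simp_rw [e]
      rw [integral_const_mul, this, e', Complex.ofReal_mul]
      linear_combination (P.real (history S x n) * G.weight c d *
        (Complex.exp ((τ * inner ℝ (x n) t : ℝ) * Complex.I) *
          Complex.exp ((τ * (inner ℝ (G.jump c d) t - b) : ℝ) * Complex.I)) *
        charIter G.weight (fun c d => inner ℝ (G.jump c d) t - b) next τ m (next c d) : ℂ) * e''
    · refine (integrable_const (1 : ℝ)).mono' ?_ (.of_forall fun ω => ?_)
      · have := hS.measurable (n + (m + 1))
        exact Measurable.aestronglyMeasurable (by fun_prop)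
      · rw [Complex.norm_exp_ofReal_mul_I]

lemma IsRandomWalk.integral_exp [IsProbabilityMeasure P] (hS : G.IsRandomWalk P S)
    (t : E3) (b τ : ℝ) (m : ℕ) :
    ∫ ω, Complex.exp ((τ * (inner ℝ (S m ω) t - m * b) : ℝ) * Complex.I) ∂P =
      charIter G.weight (fun c d => inner ℝ (G.jump c d) t - b) next τ m (0, 0) := by
  have h := hS.setIntegral_exp t b τ m (0, 0) 0 (fun _ => 0) G.zero_mem_vertices
  have hfull : history S (fun _ => 0) 0 =ᵐ[P] Set.univ := by
    refine eventuallyEq_univ.2 ?_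
    filter_upwards [hS.start] with ω hω k hk
    rwa [Nat.le_zero.1 hk]
  rw [setIntegral_congr_set hfull, setIntegral_univ, measureReal_congr hfull] at h
  simpa using h

end Walk

/-! ### Moments of the jumps in a given direction -/

/-- First moment, in the direction `t`, of the horizontal jump from a vertex of type `(i, j)`. -/
noncomputable def horMean (t : E3) (i j : Fin 2) : ℝ :=
  ∑ k, G.prob i j k * inner ℝ (G.step i k) t

/-- Second moment, in the direction `t`, of the horizontal jump from a vertex of type `(i, j)`. -/
noncomputable def horSq (t : E3) (i j : Fin 2) : ℝ :=
  ∑ k, G.prob i j k * inner ℝ (G.step i k) t ^ 2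

/-- First moment, in the direction `t`, of the vertical jump from a vertex which allows it. -/
noncomputable def verMean (t : E3) : ℝ := G.p * (2 * G.α - 1) * inner ℝ G.up t

/-- Variance, in the direction `t`, of the jump from a vertex of type `(i, 0)`. -/
noncomputable def varZero (t : E3) (i : Fin 2) : ℝ :=
  G.horSq t i 0 + G.p * inner ℝ G.up t ^ 2 - (G.horMean t i 0 + G.verMean t) ^ 2

/-- Variance, in the direction `t`, of the jump from a vertex of type `(i, 1)`. -/
noncomputable def varOne (t : E3) (i : Fin 2) : ℝ := G.horSq t i 1 - G.horMean t i 1 ^ 2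

section Sums

variable (t : E3) (b : ℝ) (g q : Fin 2 × Fin 2 → ℝ) (i : Fin 2)

/-- The transition operator applied to the centred displacement plus a function `g` of the next type,
at a type `(i, 0)`; this is the left-hand side of the Poisson equation of the drift. -/
lemma sum_first_zero :
    ∑ d, G.weight (i, 0) d * (inner ℝ (G.jump (i, 0) d) t - b + g (next (i, 0) d)) =
      G.horMean t i 0 + G.verMean t - b + ((1 - G.p) * g (1 - i, 1) + G.p * g (1 - i, 0)) := by
  have h := G.sum_prob_zero i
  rw [Fin.sum_univ_three] at h
  simp only [Fintype.sum_sum_type, weight, jump, next, Sum.elim_inl, Sum.elim_inr, if_true,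
    Fin.sum_univ_three, Fin.sum_univ_two, Matrix.cons_val_zero, Matrix.cons_val_one, horMean,
    verMean, inner_neg_left, sub_zero]
  linear_combination (g (1 - i, 1) - b) * h

lemma sum_first_one :
    ∑ d, G.weight (i, 1) d * (inner ℝ (G.jump (i, 1) d) t - b + g (next (i, 1) d)) =
      G.horMean t i 1 - b + g (1 - i, 0) := by
  have h := G.sum_prob_one i
  rw [Fin.sum_univ_three] at h
  simp only [Fintype.sum_sum_type, weight, jump, next, Sum.elim_inl, Sum.elim_inr, one_ne_zero,
    if_false, Fin.sum_univ_three, Fin.sum_univ_two, horMean, sub_self, Pi.zero_apply]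
  linear_combination (g (1 - i, 0) - b) * h

/-- The left-hand side of the second Poisson equation at a type `(i, 0)`. The displacement and the
next type are correlated, which is why horizontal and vertical means enter separately. -/
lemma sum_second_zero :
    ∑ d, G.weight (i, 0) d * ((inner ℝ (G.jump (i, 0) d) t - b) ^ 2 / 2 +
        (inner ℝ (G.jump (i, 0) d) t - b) * g (next (i, 0) d) + q (next (i, 0) d)) =
      (G.varZero t i + (G.horMean t i 0 + G.verMean t - b) ^ 2) / 2 +
        (G.horMean t i 0 - (1 - G.p) * b) * g (1 - i, 1) + (G.verMean t - G.p * b) * g (1 - i, 0) +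
        ((1 - G.p) * q (1 - i, 1) + G.p * q (1 - i, 0)) := by
  have h := G.sum_prob_zero i
  rw [Fin.sum_univ_three] at h
  simp only [Fintype.sum_sum_type, weight, jump, next, Sum.elim_inl, Sum.elim_inr, if_true,
    Fin.sum_univ_three, Fin.sum_univ_two, Matrix.cons_val_zero, Matrix.cons_val_one, horMean,
    verMean, horSq, varZero, inner_neg_left, sub_zero]
  linear_combination (b ^ 2 / 2 - b * g (1 - i, 1) + q (1 - i, 1)) * h

lemma sum_second_one :
    ∑ d, G.weight (i, 1) d * ((inner ℝ (G.jump (i, 1) d) t - b) ^ 2 / 2 +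
        (inner ℝ (G.jump (i, 1) d) t - b) * g (next (i, 1) d) + q (next (i, 1) d)) =
      (G.varOne t i + (G.horMean t i 1 - b) ^ 2) / 2 + (G.horMean t i 1 - b) * g (1 - i, 0) +
        q (1 - i, 0) := by
  have h := G.sum_prob_one i
  rw [Fin.sum_univ_three] at h
  simp only [Fintype.sum_sum_type, weight, jump, next, Sum.elim_inl, Sum.elim_inr, one_ne_zero,
    if_false, Fin.sum_univ_three, Fin.sum_univ_two, horMean, varOne, horSq, sub_self,
    Pi.zero_apply]
  linear_combination (b ^ 2 / 2 - b * g (1 - i, 0) + q (1 - i, 0)) * h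

end Sums

section Coordinates

variable (t : E3)

lemma prob_zero_zero (i : Fin 2) : G.prob i 0 0 = 1 - G.p - G.prob i 0 1 - G.prob i 0 2 := by
  have h := G.sum_prob_zero i
  rw [Fin.sum_univ_three] at h
  linarith

lemma prob_one_zero (i : Fin 2) : G.prob i 1 0 = 1 - G.prob i 1 1 - G.prob i 1 2 := by
  have h := G.sum_prob_one i
  rw [Fin.sum_univ_three] at h
  linarith

lemma inner_up : inner ℝ G.up t = G.h * t 2 := by
  simp [up, PiLp.inner_apply, Fin.sum_univ_three, mul_comm]

lemma inner_step (i : Fin 2) (k : Fin 3) : inner ℝ (G.step i k) t =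
    (-1) ^ (i : ℕ) * (G.a * ![1, -1 / 2, -1 / 2] k * t 0 +
      G.a * (√3 / 2 * ![0, 1, -1] k) * t 1) := by
  rw [step_eq]
  simp only [PiLp.inner_apply, Fin.sum_univ_three, RCLike.inner_apply, conj_trivial]
  simp
  ring

lemma inner_μ : inner ℝ G.μ t = (G.horMean t 0 0 + G.horMean t 1 0 + G.horMean t 0 1 +
    G.horMean t 1 1) / 4 + G.verMean t / 2 := by
  simp only [horMean, verMean, inner_step, inner_up, Fin.sum_univ_three, prob_zero_zero,
    prob_one_zero]
  simp [μ, u, v, PiLp.inner_apply, Fin.sum_univ_three]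
  ring

lemma inner_m : inner ℝ G.m t = (G.horMean t 0 0 + G.horMean t 1 0 - G.horMean t 0 1 -
    G.horMean t 1 1) / 4 + G.verMean t / 2 := by
  simp only [horMean, verMean, inner_step, inner_up, Fin.sum_univ_three, prob_zero_zero,
    prob_one_zero]
  simp [m, u, v, PiLp.inner_apply, Fin.sum_univ_three]
  ring

lemma inner_θ : inner ℝ G.θ t = (G.horMean t 0 0 - G.horMean t 1 0 + G.horMean t 0 1 -
    G.horMean t 1 1) / 4 := by
  simp only [horMean, inner_step, Fin.sum_univ_three, prob_zero_zero, prob_one_zero]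
  simp [θ, u, v, PiLp.inner_apply, Fin.sum_univ_three]
  ring

lemma inner_ρ : inner ℝ G.ρ t = (G.horMean t 0 0 - G.horMean t 1 0 - G.horMean t 0 1 +
    G.horMean t 1 1) / 4 := by
  simp only [horMean, inner_step, Fin.sum_univ_three, prob_zero_zero, prob_one_zero]
  simp [ρ, u, v, PiLp.inner_apply, Fin.sum_univ_three]
  ring

lemma inner_ζ : inner ℝ G.ζ t = G.verMean t := by
  rw [verMean, inner_up]
  simp [ζ, PiLp.inner_apply, Fin.sum_univ_three]
  ring

lemma dotProduct_outer_mulVec (x y : E3) :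
    t.ofLp ⬝ᵥ outer x y *ᵥ t.ofLp = inner ℝ x t * inner ℝ y t := by
  simp [outer, Matrix.mulVec, dotProduct, PiLp.inner_apply, Fin.sum_univ_three]
  ring

/-- The matrices `σ²`, `γ` and `δ` are signed means of the covariances of the jumps from the four
types of vertices. -/
lemma dotProduct_sigmaSq_mulVec : t.ofLp ⬝ᵥ G.sigmaSq *ᵥ t.ofLp =
    (G.varZero t 0 + G.varZero t 1 + G.varOne t 0 + G.varOne t 1) / 4 := by
  have h3 : √(3 : ℝ) ^ 2 = 3 := Real.sq_sqrt (by norm_num)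
  simp only [varZero, varOne, horSq, horMean, verMean, inner_step, inner_up, Fin.sum_univ_three,
    prob_zero_zero, prob_one_zero]
  simp [sigmaSq, σ11, σ12, σ22, c13, c23, c33, u, v, s, Params.t, Matrix.mulVec, dotProduct,
    Fin.sum_univ_three]
  ring_nf
  simp only [h3]
  ring

lemma dotProduct_gamma_mulVec : t.ofLp ⬝ᵥ G.gamma *ᵥ t.ofLp =
    (G.varZero t 0 + G.varZero t 1 - G.varOne t 0 - G.varOne t 1) / 4 := by
  have h3 : √(3 : ℝ) ^ 2 = 3 := Real.sq_sqrt (by norm_num)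
  simp only [varZero, varOne, horSq, horMean, verMean, inner_step, inner_up, Fin.sum_univ_three,
    prob_zero_zero, prob_one_zero]
  simp [gamma, γ11, γ12, γ22, c13, c23, c33, u, v, s, Params.t, Matrix.mulVec, dotProduct,
    Fin.sum_univ_three]
  ring_nf
  simp only [h3]
  ring

lemma dotProduct_delta_mulVec : t.ofLp ⬝ᵥ G.delta *ᵥ t.ofLp =
    (G.varZero t 0 - G.varZero t 1 - G.varOne t 0 + G.varOne t 1) / 4 := by
  have h3 : √(3 : ℝ) ^ 2 = 3 := Real.sq_sqrt (by norm_num)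
  simp only [varZero, varOne, horSq, horMean, verMean, inner_step, inner_up, Fin.sum_univ_three,
    prob_zero_zero, prob_one_zero]
  simp [delta, δ11, δ12, δ22, δ13, δ23, u, v, s, Params.t, Matrix.mulVec, dotProduct,
    Fin.sum_univ_three]
  ring_nf
  simp only [h3]
  ring

end Coordinates

/-! ### Poisson equations -/

/-- A solution of the Poisson equation of the chain of types with right-hand side `f`, normalized to
vanish at `(1, 0)`, when `p > 0` and `f` has mean zero for the stationary law, which is proportional
to `1` on the types `(i, 0)` and to `1 - p` on the types `(i, 1)`. -/
noncomputable def poisson (p : ℝ) (f : Fin 2 × Fin 2 → ℝ) (c : Fin 2 × Fin 2) : ℝ :=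
  ![![(f (0, 0) + (1 - p) * f (1, 1)) / p, f (0, 1)],
    ![0, (f (0, 0) + (1 - p) * f (1, 1)) / p + f (1, 1)]] c.1 c.2

lemma poisson_zero {p : ℝ} (hp : p ≠ 0) {f : Fin 2 × Fin 2 → ℝ}
    (hf : f (0, 0) + f (1, 0) + (1 - p) * (f (0, 1) + f (1, 1)) = 0) (i : Fin 2) :
    f (i, 0) + ((1 - p) * poisson p f (1 - i, 1) + p * poisson p f (1 - i, 0)) =
      poisson p f (i, 0) := by
  fin_cases i
  · simp [poisson]
    field_simp
    ring
  · simp [poisson]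
    field_simp
    linear_combination hf

lemma poisson_one (p : ℝ) (f : Fin 2 × Fin 2 → ℝ) (i : Fin 2) :
    f (i, 1) + poisson p f (1 - i, 0) = poisson p f (i, 1) := by
  fin_cases i
  · simp [poisson]
  · simp [poisson]
    ring

/-- The quadratic form of `Γ`. -/
lemma dotProduct_Gamma_mulVec (t : E3) : t.ofLp ⬝ᵥ G.Gamma *ᵥ t.ofLp =
    t.ofLp ⬝ᵥ G.sigmaSq *ᵥ t.ofLp + G.p / (2 - G.p) * (t.ofLp ⬝ᵥ G.gamma *ᵥ t.ofLp) +
      4 / (2 - G.p) ^ 2 * ((inner ℝ G.ζ t - G.p * inner ℝ G.μ t) * inner ℝ G.m t) -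
      4 * G.p / (2 - G.p) ^ 3 * inner ℝ G.m t ^ 2 +
      4 / (2 - G.p) * (inner ℝ G.θ t * inner ℝ G.ρ t) +
      4 / (G.p * (2 - G.p)) * inner ℝ G.ρ t ^ 2 := by
  simp only [Gamma, Matrix.add_mulVec, Matrix.sub_mulVec, Matrix.smul_mulVec, dotProduct_add,
    dotProduct_sub, dotProduct_smul, dotProduct_outer_mulVec, smul_eq_mul, inner_sub_left,
    real_inner_smul_left]
  ring

/-- The limit of the characteristic functions when `p > 0`. -/
lemma tendsto_charIter_of_pos (hp : 0 < G.p) (t : E3) :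
    Tendsto (fun n : ℕ => charIter G.weight
      (fun c d => inner ℝ (G.jump c d) t - inner ℝ (G.μ + (G.p / (2 - G.p)) • G.m) t) next
        (√(n : ℝ))⁻¹ n (0, 0)) atTop
      (𝓝 (Complex.exp (-((t.ofLp ⬝ᵥ G.Gamma *ᵥ t.ofLp) / 2 : ℝ)))) := by
  have hp2 : 2 - G.p ≠ 0 := by linarith [G.p_le_one]
  set b : ℝ := inner ℝ (G.μ + (G.p / (2 - G.p)) • G.m) t with hb
  set V : ℝ := t.ofLp ⬝ᵥ G.Gamma *ᵥ t.ofLp with hV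
  -- The centred drift, and the source term of the second Poisson equation.
  set f : Fin 2 × Fin 2 → ℝ := fun c =>
    ![G.horMean t c.1 0 + G.verMean t - b, G.horMean t c.1 1 - b] c.2 with hf
  set g := poisson G.p f with hg
  set r : Fin 2 × Fin 2 → ℝ := fun c =>
    ![(G.varZero t c.1 + (G.horMean t c.1 0 + G.verMean t - b) ^ 2) / 2 +
        (G.horMean t c.1 0 - (1 - G.p) * b) * g (1 - c.1, 1) +
        (G.verMean t - G.p * b) * g (1 - c.1, 0) - V / 2,
      (G.varOne t c.1 + (G.horMean t c.1 1 - b) ^ 2) / 2 +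
        (G.horMean t c.1 1 - b) * g (1 - c.1, 0) - V / 2] c.2 with hr
  have hbval : b = (G.horMean t 0 0 + G.horMean t 1 0 + 2 * G.verMean t +
      (1 - G.p) * (G.horMean t 0 1 + G.horMean t 1 1)) / (2 * (2 - G.p)) := by
    rw [hb, inner_add_left, real_inner_smul_left, inner_μ, inner_m]
    field_simp
    ring
  have hfmean : f (0, 0) + f (1, 0) + (1 - G.p) * (f (0, 1) + f (1, 1)) = 0 := by
    simp [hf, hbval]
    field_simp
    ring
  -- This is where the formula for `Γ` is used: `V` is the asymptotic variance.
  have hrmean : r (0, 0) + r (1, 0) + (1 - G.p) * (r (0, 1) + r (1, 1)) = 0 := by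
    simp [hr, hg, poisson, hf]
    rw [hV, dotProduct_Gamma_mulVec, dotProduct_sigmaSq_mulVec, dotProduct_gamma_mulVec, inner_μ,
      inner_m, inner_θ, inner_ρ, inner_ζ, hbval]
    field_simp
    ring
  -- Since `f` and `r` have mean zero, `poisson` solves both equations on all four types.
  refine tendsto_charIter Set.univ (g := g) (q := poisson G.p r) (fun _ _ _ _ => trivial)
    (fun c _ d => G.weight_nonneg c d) (fun c _ => G.sum_weight c) ?_ ?_ (Set.mem_univ _)
  · rintro ⟨i, j⟩ -
    fin_cases j
    · exact (G.sum_first_zero t b g i).trans (poisson_zero hp.ne' hfmean i)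
    · exact (G.sum_first_one t b g i).trans (poisson_one G.p f i)
  · rintro ⟨i, j⟩ -
    fin_cases j
    · refine (G.sum_second_zero t b g _ i).trans ?_
      change _ = poisson G.p r (i, 0) + V / 2
      rw [← poisson_zero hp.ne' hrmean i,
        show r (i, 0) = (G.varZero t i + (G.horMean t i 0 + G.verMean t - b) ^ 2) / 2 +
          (G.horMean t i 0 - (1 - G.p) * b) * g (1 - i, 1) +
          (G.verMean t - G.p * b) * g (1 - i, 0) - V / 2 from rfl]
      ring
    · refine (G.sum_second_one t b g _ i).trans ?_
      change _ = poisson G.p r (i, 1) + V / 2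
      rw [← poisson_one G.p r i,
        show r (i, 1) = (G.varOne t i + (G.horMean t i 1 - b) ^ 2) / 2 +
          (G.horMean t i 1 - b) * g (1 - i, 0) - V / 2 from rfl]
      ring

/-- The limit of the characteristic functions when `p = 0`: the walk then alternates between the
types `(0, 0)` and `(1, 1)`. -/
lemma tendsto_charIter_of_eq_zero (hp : G.p = 0) (t : E3) :
    Tendsto (fun n : ℕ => charIter G.weight
      (fun c d => inner ℝ (G.jump c d) t - inner ℝ (G.μ + G.ρ) t) next (√(n : ℝ))⁻¹ n (0, 0)) atTop
      (𝓝 (Complex.exp (-((t.ofLp ⬝ᵥ (G.sigmaSq + G.delta) *ᵥ t.ofLp) / 2 : ℝ)))) := by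
  set b : ℝ := inner ℝ (G.μ + G.ρ) t with hb
  set V : ℝ := t.ofLp ⬝ᵥ (G.sigmaSq + G.delta) *ᵥ t.ofLp with hV
  have hz : G.verMean t = 0 := by simp [verMean, hp]
  have hbval : b = (G.horMean t 0 0 + G.horMean t 1 1) / 2 := by
    rw [hb, inner_add_left, inner_μ, inner_ρ, hz]
    ring
  have hVval : V = (G.varZero t 0 + G.varOne t 1) / 2 := by
    rw [hV, Matrix.add_mulVec, dotProduct_add, dotProduct_sigmaSq_mulVec, dotProduct_delta_mulVec]
    ring
  set g : Fin 2 × Fin 2 → ℝ := fun c => ![![G.horMean t 0 0 - b, 0], ![0, 0]] c.1 c.2 with hg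
  set q : Fin 2 × Fin 2 → ℝ := fun c => ![![0, 0],
    ![0, (G.varOne t 1 + (G.horMean t 1 1 - b) ^ 2) / 2 +
      (G.horMean t 1 1 - b) * (G.horMean t 0 0 - b) - V / 2]] c.1 c.2 with hq
  refine tendsto_charIter {(0, 0), (1, 1)} (g := g) (q := q) ?_
    (fun c _ d => G.weight_nonneg c d) (fun c _ => G.sum_weight c) ?_ ?_ (Or.inl rfl)
  · rintro c (rfl | rfl) d hd
    · rcases d with k | k
      · exact Or.inr rfl
      · refine absurd ?_ hd
        fin_cases k <;> simp [weight, hp]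
    · rcases d with k | k
      · exact Or.inl rfl
      · exact absurd (by simp [weight]) hd
  · rintro c (rfl | rfl)
    · refine (G.sum_first_zero t b g 0).trans ?_
      rw [hz, hp]
      simp [hg]
    · refine (G.sum_first_one t b g 1).trans ?_
      simp [hg, hbval]
      ring
  · rintro c (rfl | rfl)
    · refine (G.sum_second_zero t b g q 0).trans ?_
      rw [hz, hp]
      simp [hg, hq, hbval, hVval]
      ring
    · refine (G.sum_second_one t b g q 1).trans ?_
      simp [hg, hq, hbval, hVval]

/-! ### Convergence in distribution -/

variable {G} {Ω : Type*} [MeasurableSpace Ω] {P : Measure Ω} {S : ℕ → Ω → E3}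

lemma isHermitian_of_symm {M : Matrix (Fin 3) (Fin 3) ℝ} (h : Mᵀ = M) : M.IsHermitian := by
  rw [Matrix.IsHermitian, Matrix.conjTranspose_eq_transpose_of_trivial, h]

lemma outer_transpose (x y : E3) : (outer x y)ᵀ = outer y x := by
  ext i j
  simp [outer, mul_comm]

lemma sigmaSq_transpose : G.sigmaSqᵀ = G.sigmaSq := by
  ext i j
  fin_cases i <;> fin_cases j <;> rfl

lemma gamma_transpose : G.gammaᵀ = G.gamma := by
  ext i j
  fin_cases i <;> fin_cases j <;> rfl

lemma delta_transpose : G.deltaᵀ = G.delta := by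
  ext i j
  fin_cases i <;> fin_cases j <;> rfl

lemma Gamma_transpose : G.Gammaᵀ = G.Gamma := by
  simp only [Gamma, Matrix.transpose_add, Matrix.transpose_sub, Matrix.transpose_smul,
    outer_transpose, sigmaSq_transpose, gamma_transpose]
  rw [add_comm (outer G.m _), add_comm (outer G.ρ _)]

/-- Lévy's continuity theorem, applied to the walk. The matrix `M` is positive semidefinite since a
limit of characteristic functions is bounded by one. -/
lemma IsRandomWalk.tendstoInDistribution [IsProbabilityMeasure P] (hS : G.IsRandomWalk P S)
    {ν : E3} {M : Matrix (Fin 3) (Fin 3) ℝ} (hM : Mᵀ = M)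
    (h : ∀ t : E3, Tendsto (fun n : ℕ => charIter G.weight
      (fun c d => inner ℝ (G.jump c d) t - inner ℝ ν t) next (√(n : ℝ))⁻¹ n (0, 0)) atTop
      (𝓝 (Complex.exp (-((t.ofLp ⬝ᵥ M *ᵥ t.ofLp) / 2 : ℝ))))) :
    M.PosSemidef ∧ TendstoInDistribution
      (fun (n : ℕ) ω => (√(n : ℝ))⁻¹ • (S n ω - (n : ℝ) • ν)) atTop (id : E3 → E3) (fun _ => P)
      (multivariateGaussian 0 M) := by
  have hpsd : M.PosSemidef := by
    refine Matrix.PosSemidef.of_dotProduct_mulVec_nonneg (isHermitian_of_symm hM) fun y => ?_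
    have hle : ∀ n : ℕ, ‖charIter G.weight (fun c d => inner ℝ (G.jump c d) (WithLp.toLp 2 y) -
        inner ℝ ν (WithLp.toLp 2 y)) next (√(n : ℝ))⁻¹ n (0, 0)‖ ≤ 1 := fun n => by
      rw [← hS.integral_exp]
      refine (norm_integral_le_of_norm_le_const (C := 1) (.of_forall fun ω => ?_)).trans (by simp)
      rw [Complex.norm_exp_ofReal_mul_I]
    have := le_of_tendsto (h (WithLp.toLp 2 y)).norm (.of_forall hle)
    rw [← Complex.ofReal_neg, Complex.norm_exp_ofReal, Real.exp_le_one_iff] at this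
    rw [star_trivial]
    linarith
  have hmeas : ∀ n : ℕ, Measurable fun ω => (√(n : ℝ))⁻¹ • (S n ω - (n : ℝ) • ν) := fun n => by
    have := hS.measurable n
    fun_prop
  refine ⟨hpsd, fun n => (hmeas n).aemeasurable, aemeasurable_id,
    ProbabilityMeasure.tendsto_iff_tendsto_charFun.2 fun t => ?_⟩
  simp only [ProbabilityMeasure.coe_mk, Measure.map_id]
  rw [charFun_multivariateGaussian hpsd]
  have hlim : Complex.exp (inner ℝ t (0 : E3) * Complex.I - (t.ofLp ⬝ᵥ M *ᵥ t.ofLp : ℝ) / 2) =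
      Complex.exp (-((t.ofLp ⬝ᵥ M *ᵥ t.ofLp) / 2 : ℝ)) := by
    simp
  rw [hlim]
  refine (h t).congr fun n => ?_
  rw [← hS.integral_exp, charFun_apply, integral_map (hmeas n).aemeasurable (by fun_prop)]
  refine integral_congr_ae (.of_forall fun ω => ?_)
  simp only [inner_smul_left, inner_sub_left, conj_trivial]

end Params

end Graphite

theorem theorem4 {Ω : Type*} [MeasurableSpace Ω] (P : Measure Ω) [IsProbabilityMeasure P]
    (G : Graphite.Params) (S : ℕ → Ω → Graphite.E3) (hS : G.IsRandomWalk P S) :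
    (0 < G.p →
      G.Gamma.PosSemidef ∧
      TendstoInDistribution
        (fun (n : ℕ) ω =>
          (√(n : ℝ))⁻¹ • (S n ω - (n : ℝ) • G.μ - ((n : ℝ) * (G.p / (2 - G.p))) • G.m))
        atTop (id : Graphite.E3 → Graphite.E3) (fun _ => P) (multivariateGaussian 0 G.Gamma)) ∧
    (G.p = 0 →
      (G.sigmaSq + G.delta).PosSemidef ∧
      TendstoInDistribution
        (fun (n : ℕ) ω => (√(n : ℝ))⁻¹ • (S n ω - (n : ℝ) • (G.μ + G.ρ)))
        atTop (id : Graphite.E3 → Graphite.E3) (fun _ => P)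
        (multivariateGaussian 0 (G.sigmaSq + G.delta))) := by
  refine ⟨fun hp => ?_, fun hp => ?_⟩
  · have h := hS.tendstoInDistribution Graphite.Params.Gamma_transpose (G.tendsto_charIter_of_pos hp)
    simpa only [smul_add, smul_smul, sub_add_eq_sub_sub] using h
  · exact hS.tendstoInDistribution
      (by rw [Matrix.transpose_add, Graphite.Params.sigmaSq_transpose,
        Graphite.Params.delta_transpose])
      (G.tendsto_charIter_of_eq_zero hp)
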